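/- Let $n \ge 1$. The fan graph $F_n$ has vertices $0,1,\dots,n$, with edges $\{i,i+1\}$ for $1\le i<n$ and $\{0,i\}$ for $1\le i\le n$; the vertex $0$ is the sink. A configuration is a vector $c=(c_1,\dots,c_n)$ of non-negative integers ($c_i$ is the number of grains at $i$). It is stable if $c_i<\deg(i)$ for all $i\in\{1,\dots,n\}$, where $\deg$ is the degree in $F_n$; otherwise each $i$ with $c_i\ge\deg(i)$ is unstable. In the Abelian sandpile model, an unstable vertex topples by sending one grain to each of its neighbours; in the stochastic sandpile model with parameter $p\in(0,1)$, it sends one grain to each neighbour independently with probability $p$ and keeps the other grains. Grains sent to the sink disappear. Fix a probability distribution $\mu$ on $\{1,\dots,n\}$ with $\mu_i>0$ for all $i$. Each model defines a Markov chain on the stable configurations: at each step, add a grain at a vertex chosen according to $\mu$, then topple unstable vertices one after the other (in the stochastic model, in an order given by any fixed rule that selects an unstable vertex of the current unstable configuration) until a stable configuration is reached. A stable configuration is recurrent if, from every stable initial configuration, it is almost surely visited infinitely often by the chain. Let $c\in\{0,1,2\}^n$ with $c_1,c_n\le 1$ be a stable configuration on $F_n$. Then the following holds for the Abelian sandpile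 model, and also for the stochastic sandpile model: $c$ is recurrent if and only if for all $i,j\in\{1,\dots,n\}$ with $i<j$ and $c_i=c_j=0$ there exists $k$ with $i<k<j$ and $c_k=2$. -/

import Mathlib

open MeasureTheory ProbabilityTheory Filter

namespace Sandpile

/-!
Graphs with a sink have vertex set `{0, 1, …, n}`, modelled by `Fin (n + 1)`, with sink `0`.
The non-sink vertices `1, …, n` are `i.succ` for `i : Fin n`.
-/

/-- A configuration: `c i` is the number of grains at the non-sink vertex `i.succ`. -/
abbrev Config (n : ℕ) : Type := Fin n → ℕ

/-- The fan graph: the join of the path on the vertices `1, …, n` and of the single vertex `0`. -/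
def fan (n : ℕ) : SimpleGraph (Fin (n + 1)) where
  Adj u v := u ≠ v ∧ (u = 0 ∨ v = 0 ∨ u.val + 1 = v.val ∨ v.val + 1 = u.val)
  symm := ⟨fun _ _ h => ⟨h.1.symm, by tauto⟩⟩
  loopless := ⟨fun _ h => h.1 rfl⟩

instance (n : ℕ) : DecidableRel (fan n).Adj := fun u v =>
  inferInstanceAs (Decidable (u ≠ v ∧ (u = 0 ∨ v = 0 ∨ u.val + 1 = v.val ∨ v.val + 1 = u.val)))

variable {n : ℕ} (G : SimpleGraph (Fin (n + 1))) [DecidableRel G.Adj]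

/-- The non-sink vertex `i` is stable in `c` if it has fewer grains than its degree
(which counts the edge to the sink, if there is one). -/
def StableAt (c : Config n) (i : Fin n) : Prop := c i < G.degree i.succ

/-- A configuration is stable if all its non-sink vertices are stable. -/
def IsStable (c : Config n) : Prop := ∀ i, StableAt G c i

/-- Adding one grain at the vertex `i`. -/
def addGrain (c : Config n) (i : Fin n) : Config n := c + Pi.single i 1

/-- The vertex `i` sends one grain to each vertex of the set `S`; the sink absorbs grains.
(Only used when `i ∉ S` and `i` has at least as many grains as `S` has elements.) -/
def send (c : Config n) (i : Fin n) (S : Finset (Fin (n + 1))) : Config n := fun j =>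
  (c j - if j = i then S.card else 0) + if j.succ ∈ S then 1 else 0

/-! ### The Abelian sandpile model -/

/-- The toppling of the vertex `i`: one grain is sent to each neighbour. -/
def topple (c : Config n) (i : Fin n) : Config n := send c i (G.neighborFinset i.succ)

/-- One legal toppling: an unstable vertex of `c` topples. -/
def ToppleStep (c c' : Config n) : Prop := ∃ i, ¬ StableAt G c i ∧ c' = topple G c i

/-- `s` is a stable configuration reached from `c` by successively toppling unstable vertices. -/
def IsStabilisation (c s : Config n) : Prop :=
  Relation.ReflTransGen (ToppleStep G) c s ∧ IsStable G s

open Classical in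
/-- The stabilisation of `c`. On a connected graph it exists and does not depend on the order
of the topplings, so that the choice is immaterial and the default value is never taken. -/
noncomputable def stabilise (c : Config n) : Config n :=
  if h : ∃ s, IsStabilisation G c s then h.choose else c

/-- The Markov chain of the Abelian sandpile model started from `c₀`, where `ω k` is the vertex at
which a grain is added in the step from time `k` to time `k + 1`. -/
noncomputable def asmChain (c₀ : Config n) (ω : ℕ → Fin n) : ℕ → Config n
  | 0 => c₀
  | k + 1 => stabilise G (addGrain (asmChain c₀ ω k) (ω k))

/-- `c` is recurrent for the Abelian sandpile model, where grains are added at independent random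
vertices of law `μ`: from every stable initial configuration, the Markov chain almost surely
visits `c` infinitely often. -/
def ASMRecurrent (μ : PMF (Fin n)) (c : Config n) : Prop :=
  ∀ c₀ : Config n, IsStable G c₀ →
    ∀ᵐ ω ∂(Measure.infinitePi fun _ : ℕ => μ.toMeasure), ∃ᶠ k in atTop, asmChain G c₀ ω k = c

/-! ### The stochastic sandpile model -/

/-- The outcome of the coin flips of one toppling: one coin for each possible receiver. -/
abbrev Coins (n : ℕ) : Type := Fin (n + 1) → Bool

/-- The law of the coins of one toppling: independent, each `true` with probability `p`. -/
noncomputable def coinLaw (n : ℕ) (p : unitInterval) : Measure (Coins n) :=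
  Measure.pi fun _ => bernoulliMeasure true false p

/-- The random toppling of the vertex `i`: one grain is sent to each neighbour whose coin shows
`true`, the other grains stay at `i`. -/
def randTopple (c : Config n) (i : Fin n) (b : Coins n) : Config n :=
  send c i ((G.neighborFinset i.succ).filter fun j => b j = true)

/-- A toppling rule says which vertex is the next one to topple; it has to be an unstable vertex
of each configuration that is not stable. -/
def IsToppleRule (r : Config n → Fin n) : Prop := ∀ c, ¬ IsStable G c → ¬ StableAt G c (r c)

open Classical in
/-- The configuration after `t` random topplings, the `s`-th of which uses the coins `b s`;
nothing changes any more once a stable configuration is reached. -/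
noncomputable def randTopplings (r : Config n → Fin n) (b : ℕ → Coins n) (c : Config n) :
    ℕ → Config n
  | 0 => c
  | t + 1 =>
    if IsStable G (randTopplings r b c t) then randTopplings r b c t
    else randTopple G (randTopplings r b c t) (r (randTopplings r b c t)) (b t)

open Classical in
/-- The random stabilisation of `c`: the first stable configuration that is reached
(on a connected graph, for `p ≠ 0`, there almost surely is one). -/
noncomputable def randStabilise (r : Config n → Fin n) (b : ℕ → Coins n) (c : Config n) :
    Config n :=
  if h : ∃ t, IsStable G (randTopplings G r b c t) then randTopplings G r b c (Nat.find h) else c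

/-- The Markov chain of the stochastic sandpile model started from `c₀`. In the step from time `k`
to time `k + 1`, a grain is added at the vertex `(ω k).1`, and the coins of the successive
topplings of the stabilisation are `(ω k).2 0`, `(ω k).2 1`, … -/
noncomputable def ssmChain (r : Config n → Fin n) (c₀ : Config n)
    (ω : ℕ → Fin n × (ℕ → Coins n)) : ℕ → Config n
  | 0 => c₀
  | k + 1 => randStabilise G r (ω k).2 (addGrain (ssmChain r c₀ ω k) (ω k).1)

/-- The law of the randomness of one step of the stochastic sandpile model: a vertex of law `μ`,
and, independently, the coins of a sequence of independent topplings. -/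
noncomputable def ssmStepLaw (μ : PMF (Fin n)) (p : unitInterval) :
    Measure (Fin n × (ℕ → Coins n)) :=
  μ.toMeasure.prod (Measure.infinitePi fun _ : ℕ => coinLaw n p)

/-- `c` is recurrent for the stochastic sandpile model (with law `μ` of the added grains, coin
parameter `p` and toppling rule `r`): from every stable initial configuration, the Markov chain
almost surely visits `c` infinitely often. -/
def SSMRecurrent (μ : PMF (Fin n)) (p : unitInterval) (r : Config n → Fin n) (c : Config n) :
    Prop :=
  ∀ c₀ : Config n, IsStable G c₀ →
    ∀ᵐ ω ∂(Measure.infinitePi fun _ : ℕ => ssmStepLaw μ p),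
      ∃ᶠ k in atTop, ssmChain G r c₀ ω k = c

end Sandpile

namespace Sandpile

/-! ### Grain counts in one toppling. -/

section SendArithmetic

variable {n : ℕ}

/-! The proof closes a cycle of implications: the condition on zeros and twos ⇒ the burning test ⇒
recurrence (in either model) ⇒ `DominatesEdges` ⇒ the condition.

On the fan, the condition leaves no nonempty set `A` in which every vertex has fewer grains than
neighbours in `A` (`exists_degreeIn_fan_le`). Vertices can then burn one by one, so that `c + 1`
topples to `c` (`reflTransGen_add_one`). Hence `c` is reached from any stable `x` by adding `c + n •
1 - x` (`exists_foldl_asmStep_eq`). Finiteness of the state space and independence of the steps turn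
reachability into infinitely many visits (`ae_frequently_eq`). The stochastic chain imitates an
Abelian step with positive probability, namely when enough coins all show `true`.

Conversely, `DominatesEdges` survives even partial topplings of unstable vertices
(`DominatesEdges.send`) and holds for some stable configuration, hence for every recurrent one. An
interval between two zeros without a 2 would violate it (`DominatesEdges.exists_eq_two`). -/

theorem card_eq_sink_add (S : Finset (Fin (n + 1))) :
    S.card = (if 0 ∈ S then 1 else 0) + ∑ j : Fin n, if j.succ ∈ S then 1 else 0 := by
  rw [← Fin.sum_univ_succ (f := fun v => if v ∈ S then 1 else 0)]
  simp

theorem send_apply_add {c : Config n} {i : Fin n} {S : Finset (Fin (n + 1))}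
    (h : S.card ≤ c i) (j : Fin n) :
    send c i S j + (if j = i then S.card else 0) = c j + if j.succ ∈ S then 1 else 0 := by
  unfold send
  split_ifs with h1 <;> subst_vars <;> omega

theorem sum_send_add {c : Config n} {i : Fin n} {S : Finset (Fin (n + 1))} (h : S.card ≤ c i) :
    ∑ j, send c i S j + (if 0 ∈ S then 1 else 0) = ∑ j, c j := by
  have h1 := Finset.sum_congr (rfl : (Finset.univ : Finset (Fin n)) = _)
    fun j _ => send_apply_add h j
  rw [Finset.sum_add_distrib, Finset.sum_add_distrib] at h1
  have h2 := card_eq_sink_add S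
  simp only [Finset.sum_ite_eq', Finset.mem_univ, if_true] at h1
  omega

theorem send_add {c : Config n} {i : Fin n} {S : Finset (Fin (n + 1))} (h : S.card ≤ c i)
    (d : Config n) : send (c + d) i S = send c i S + d := by
  funext j
  have h1 := send_apply_add h j
  have h2 := send_apply_add (c := c + d) (i := i) (S := S) (by simp; omega) j
  simp only [Pi.add_apply] at h2 ⊢
  omega

end SendArithmetic

/-! ### Abelian property and burning test. -/

section Abelian

variable {n : ℕ} {G : SimpleGraph (Fin (n + 1))} [DecidableRel G.Adj]

theorem not_stableAt {c : Config n} {i : Fin n} : ¬ StableAt G c i ↔ G.degree i.succ ≤ c i := by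
  simp [StableAt]

theorem not_isStable {c : Config n} : ¬ IsStable G c ↔ ∃ i, ¬ StableAt G c i := by
  simp [IsStable]

theorem topple_apply_add {c : Config n} {i : Fin n} (h : ¬ StableAt G c i) (j : Fin n) :
    topple G c i j + (if j = i then G.degree i.succ else 0) =
      c j + if G.Adj i.succ j.succ then 1 else 0 := by
  have := send_apply_add (S := G.neighborFinset i.succ) (not_stableAt.1 h) j
  simpa [topple] using this

theorem ToppleStep.add {a b : Config n} (h : ToppleStep G a b) (d : Config n) :
    ToppleStep G (a + d) (b + d) := by
  obtain ⟨i, hi, rfl⟩ := h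
  rw [not_stableAt] at hi
  exact ⟨i, not_stableAt.2 (hi.trans (by simp)), (send_add hi d).symm⟩

theorem reflTransGen_add {a b : Config n} (h : Relation.ReflTransGen (ToppleStep G) a b)
    (d : Config n) : Relation.ReflTransGen (ToppleStep G) (a + d) (b + d) :=
  by
  induction h with
  | refl => exact .refl
  | tail _ h ih => exact ih.tail (h.add d)

/-- Toppling one vertex never lowers another, so two unstable vertices can topple in either order.
-/
theorem ToppleStep.diamond {a b c : Config n} (hb : ToppleStep G a b) (hc : ToppleStep G a c) :
    b = c ∨ ∃ d, ToppleStep G b d ∧ ToppleStep G c d := by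
  obtain ⟨i, hi, rfl⟩ := hb
  obtain ⟨j, hj, rfl⟩ := hc
  by_cases hij : i = j
  · exact Or.inl (by rw [hij])
  right
  have hj' : ¬ StableAt G (topple G a i) j := by
    have := topple_apply_add hi j
    rw [if_neg (Ne.symm hij)] at this
    rw [not_stableAt] at hj ⊢
    omega
  have hi' : ¬ StableAt G (topple G a j) i := by
    have := topple_apply_add hj i
    rw [if_neg hij] at this
    rw [not_stableAt] at hi ⊢
    omega
  refine ⟨topple G (topple G a i) j, ⟨j, hj', rfl⟩, i, hi', ?_⟩
  funext k
  have h1 := topple_apply_add hi k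
  have h2 := topple_apply_add hj k
  have h3 := topple_apply_add hj' k
  have h4 := topple_apply_add hi' k
  omega

theorem IsStable.eq_of_reflTransGen {a b : Config n} (ha : IsStable G a)
    (h : Relation.ReflTransGen (ToppleStep G) a b) : a = b := by
  rcases h.cases_head with h | ⟨c, ⟨i, hi, -⟩, -⟩
  · exact h
  · exact absurd (ha i) hi

theorem IsStabilisation.unique {c s t : Config n} (hs : IsStabilisation G c s)
    (ht : IsStabilisation G c t) : s = t := by
  obtain ⟨d, h1, h2⟩ := Relation.church_rosser (r := ToppleStep G) (fun a b c hb hc => by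
    rcases hb.diamond hc with rfl | ⟨d, h1, h2⟩
    · exact ⟨b, .refl, .refl⟩
    · exact ⟨d, .single h1, .single h2⟩) hs.1 ht.1
  rw [hs.2.eq_of_reflTransGen h1, ht.2.eq_of_reflTransGen h2]

/-- Every vertex is adjacent to the sink, so each toppling loses a grain. -/
theorem exists_isStabilisation (hG : ∀ i : Fin n, G.Adj i.succ 0) (c : Config n) :
    ∃ s, IsStabilisation G c s := by
  induction hm : ∑ j, c j using Nat.strong_induction_on generalizing c with
  | _ m ih =>
    by_cases hc : IsStable G c
    · exact ⟨c, .refl, hc⟩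
    obtain ⟨i, hi⟩ := not_isStable.1 hc
    have h1 := sum_send_add (S := G.neighborFinset i.succ) (not_stableAt.1 hi)
    rw [if_pos (by simpa using hG i)] at h1
    change ∑ j, topple G c i j + 1 = _ at h1
    obtain ⟨s, hs, hs'⟩ := ih _ (by omega) (topple G c i) rfl
    exact ⟨s, hs.head ⟨i, hi, rfl⟩, hs'⟩

theorem isStabilisation_stabilise (hG : ∀ i : Fin n, G.Adj i.succ 0) (c : Config n) :
    IsStabilisation G c (stabilise G c) := by
  have h := exists_isStabilisation hG c
  rw [stabilise, dif_pos h]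
  exact h.choose_spec

theorem reflTransGen_stabilise (c : Config n) :
    Relation.ReflTransGen (ToppleStep G) c (stabilise G c) := by
  unfold stabilise
  split_ifs with h
  · exact h.choose_spec.1
  · exact .refl

/-- One step of the Abelian sandpile chain. -/
noncomputable def asmStep (G : SimpleGraph (Fin (n + 1))) [DecidableRel G.Adj]
    (c : Config n) (i : Fin n) : Config n := stabilise G (addGrain c i)

theorem isStable_asmStep (hG : ∀ i : Fin n, G.Adj i.succ 0) (c : Config n) (i : Fin n) :
    IsStable G (asmStep G c i) := (isStabilisation_stabilise hG _).2

/-- Topplings stay legal when more grains are present. Those made while the grains of `d` arrive one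
by one are thus legal with all of `d` present from the start. -/
theorem exists_reflTransGen_foldl_asmStep (x d : Config n) :
    ∃ w : List (Fin n), Relation.ReflTransGen (ToppleStep G) (x + d) (w.foldl (asmStep G) x) := by
  induction hm : ∑ j, d j generalizing x d with
  | zero =>
    have : d = 0 := by
      funext j
      simpa using (Finset.sum_eq_zero_iff.1 hm) j (Finset.mem_univ j)
    exact ⟨[], by simpa [this] using Relation.ReflTransGen.refl⟩
  | succ m ih =>
    obtain ⟨i, hi⟩ : ∃ i, 0 < d i := by
      by_contra! h
      simp [Nat.le_zero.1 (h _)] at hm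
    have hd : (d - Pi.single i 1) + Pi.single i 1 = d := by
      funext j
      by_cases hj : j = i
      · subst hj; simp; omega
      · simp [hj]
    have hsum : ∑ j, (d - Pi.single i 1 : Config n) j = m := by
      have : ∑ j, ((d - Pi.single i 1 : Config n) + Pi.single i 1 : Config n) j = m + 1 := by
        rw [hd, hm]
      simp only [Pi.add_apply, Finset.sum_add_distrib] at this
      simpa using this
    obtain ⟨w, hw⟩ := ih (asmStep G x i) _ hsum
    refine ⟨i :: w, Relation.ReflTransGen.trans ?_ hw⟩
    have := reflTransGen_add (reflTransGen_stabilise (G := G) (addGrain x i)) (d - Pi.single i 1)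
    have he : addGrain x i + (d - Pi.single i 1) = x + d := by
      rw [addGrain, add_assoc, add_comm (Pi.single i 1), hd]
    rwa [he] at this

theorem isStable_foldl_asmStep (hG : ∀ i : Fin n, G.Adj i.succ 0) {x : Config n}
    (hx : IsStable G x) (w : List (Fin n)) : IsStable G (w.foldl (asmStep G) x) := by
  induction w generalizing x with
  | nil => exact hx
  | cons i w ih => exact ih (isStable_asmStep hG x i)

theorem reflTransGen_add_nsmul {c d : Config n}
    (h : Relation.ReflTransGen (ToppleStep G) (c + d) c) (m : ℕ) :
    Relation.ReflTransGen (ToppleStep G) (c + m • d) c := by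
  induction m with
  | zero => simpa using Relation.ReflTransGen.refl
  | succ m ih =>
    have := reflTransGen_add h (m • d)
    rw [add_assoc, ← succ_nsmul'] at this
    exact this.trans ih

theorem IsStable.le {c : Config n} (h : IsStable G c) (i : Fin n) : c i ≤ n := by
  have h1 : c i < G.degree i.succ := h i
  have h2 := G.degree_lt_card_verts i.succ
  simp only [Fintype.card_fin] at h2
  omega

/-- A configuration that is stable and passes the burning test can be reached from every stable
configuration. -/
theorem exists_foldl_asmStep_eq (hG : ∀ i : Fin n, G.Adj i.succ 0) {c : Config n}
    (hc : IsStable G c) (hburn : Relation.ReflTransGen (ToppleStep G) (c + 1) c)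
    {x : Config n} (hx : IsStable G x) : ∃ w : List (Fin n), w.foldl (asmStep G) x = c := by
  -- Since `x ≤ n` pointwise, the truncated subtraction is exact. Both the chain along `w` and `n`
  -- rounds of burning stabilise `c + n • 1`.
  obtain ⟨w, hw⟩ := exists_reflTransGen_foldl_asmStep (G := G) x (c + n • 1 - x)
  have he : x + (c + n • 1 - x) = c + n • 1 := by
    funext i
    have := hx.le i
    simp
    omega
  rw [he] at hw
  exact ⟨w, IsStabilisation.unique ⟨hw, isStable_foldl_asmStep hG hx w⟩
    ⟨reflTransGen_add_nsmul hburn n, hc⟩⟩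

theorem degree_succ_eq (hG : ∀ i : Fin n, G.Adj i.succ 0) (i : Fin n) :
    G.degree i.succ = 1 + (Finset.univ.filter fun j : Fin n => G.Adj i.succ j.succ).card := by
  have := card_eq_sink_add (G.neighborFinset i.succ)
  simpa only [SimpleGraph.mem_neighborFinset, hG i, if_true, Finset.card_filter,
    SimpleGraph.card_neighborFinset_eq_degree] using this

/-- Dhar's burning test. -/
theorem reflTransGen_add_one (hG : ∀ i : Fin n, G.Adj i.succ 0) {c : Config n}
    (h : ∀ A : Finset (Fin n), A.Nonempty →
      ∃ i ∈ A, (A.filter fun j => G.Adj i.succ j.succ).card ≤ c i) :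
    Relation.ReflTransGen (ToppleStep G) (c + 1) c := by
  -- `A` is the set of unburnt vertices, and `x` arises from `c + 1` by toppling each burnt vertex
  -- once. Once all have burnt, each has lost its degree and regained its degree minus one.
  suffices key : ∀ (m : ℕ) (A : Finset (Fin n)), A.card = m → ∀ x : Config n,
      (∀ v, x v + (if v ∈ A then 0 else G.degree v.succ) =
        c v + 1 + (Aᶜ.filter fun u => G.Adj v.succ u.succ).card) →
      Relation.ReflTransGen (ToppleStep G) x c from
    key _ Finset.univ rfl _ (by simp)
  intro m
  induction m with
  | zero =>
    intro A hA x hx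
    rw [Finset.card_eq_zero] at hA
    have : x = c := by
      funext v
      have h1 := hx v
      have h2 := degree_succ_eq hG v
      simp [hA] at h1
      omega
    rw [this]
  | succ m ih =>
    intro A hA x hx
    -- This `i` is unstable in `x`: `c i` covers its unburnt neighbours, the grains received its
    -- burnt ones, and the extra grain the sink.
    obtain ⟨i, hi, hci⟩ := h A (Finset.card_pos.1 (by omega))
    have hun : ¬ StableAt G x i := by
      rw [not_stableAt, degree_succ_eq hG i]
      have h1 := hx i
      rw [if_pos hi] at h1
      have h2 : (Finset.univ.filter fun j : Fin n => G.Adj i.succ j.succ).card =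
          (A.filter fun j => G.Adj i.succ j.succ).card +
          (Aᶜ.filter fun j => G.Adj i.succ j.succ).card := by
        rw [← Finset.card_union_of_disjoint, ← Finset.filter_union, Finset.union_compl]
        exact Finset.disjoint_filter_filter disjoint_compl_right
      omega
    refine (ih (A.erase i) (by rw [Finset.card_erase_of_mem hi, hA]; rfl) (topple G x i) ?_).head
      ⟨i, hun, rfl⟩
    intro v
    have h1 := hx v
    have h2 := topple_apply_add hun v
    have h3 : ((A.erase i)ᶜ.filter fun u => G.Adj v.succ u.succ).card =
        (Aᶜ.filter fun u => G.Adj v.succ u.succ).card +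
          if G.Adj i.succ v.succ then 1 else 0 := by
      rw [Finset.compl_erase, Finset.filter_insert]
      simp only [G.adj_comm v.succ i.succ]
      split_ifs
      · rw [Finset.card_insert_of_notMem (by simp [hi])]
      · rfl
    rw [h3]
    by_cases hv : v = i
    · subst hv
      simp [hi] at h1 h2 ⊢
      omega
    · simp [hv] at h1 h2 ⊢
      omega

end Abelian

end Sandpile

namespace Sandpile

/-! ### The edge-counting invariant. -/

section Invariant

variable {n : ℕ} {G : SimpleGraph (Fin (n + 1))} [DecidableRel G.Adj]

/-- The degree of the non-sink vertex `i` in the set `A` of non-sink vertices. -/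
def degreeIn (G : SimpleGraph (Fin (n + 1))) [DecidableRel G.Adj] (A : Finset (Fin n))
    (i : Fin n) : ℕ := (A.filter fun j => G.Adj i.succ j.succ).card

/-- Each set of non-sink vertices has at least as many grains as inner edges. The left hand side
counts each edge twice. -/
def DominatesEdges (G : SimpleGraph (Fin (n + 1))) [DecidableRel G.Adj] (c : Config n) : Prop :=
  ∀ A : Finset (Fin n), ∑ i ∈ A, degreeIn G A i ≤ 2 * ∑ i ∈ A, c i

theorem DominatesEdges.mono {c d : Config n} (h : DominatesEdges G c) (hcd : c ≤ d) :
    DominatesEdges G d := fun A =>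
  (h A).trans (Nat.mul_le_mul_left 2 (Finset.sum_le_sum fun i _ => hcd i))

theorem DominatesEdges.addGrain {c : Config n} (h : DominatesEdges G c) (i : Fin n) :
    DominatesEdges G (addGrain c i) :=
  h.mono (le_add_of_nonneg_right (Pi.single_nonneg.2 zero_le_one))

theorem dominatesEdges_of_le {c : Config n}
    (h : ∀ i, degreeIn G Finset.univ i ≤ c i) : DominatesEdges G c := by
  intro A
  rw [Finset.mul_sum]
  refine Finset.sum_le_sum fun i _ => ?_
  have h1 : degreeIn G A i ≤ degreeIn G Finset.univ i :=
    Finset.card_le_card (Finset.filter_subset_filter _ (Finset.subset_univ A))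
  have := h i
  omega

theorem sum_degreeIn_insert {A : Finset (Fin n)} {i : Fin n} (hi : i ∉ A) :
    ∑ j ∈ insert i A, degreeIn G (insert i A) j =
      ∑ j ∈ A, degreeIn G A j + 2 * degreeIn G A i := by
  have h1 : ∀ j, degreeIn G (insert i A) j =
      degreeIn G A j + if G.Adj i.succ j.succ then 1 else 0 := by
    intro j
    simp only [degreeIn, Finset.card_filter, Finset.sum_insert hi, G.adj_comm j.succ i.succ]
    rw [add_comm]
  rw [Finset.sum_insert hi]
  simp only [h1, Finset.sum_add_distrib]
  rw [if_neg (G.loopless.irrefl _)]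
  simp only [degreeIn, Finset.card_filter]
  omega

/-- Inclusion–exclusion for `S` and the neighbours in `A`, both inside the neighbourhood of `i`. -/
theorem card_add_degreeIn_le {A : Finset (Fin n)} {i : Fin n} {S : Finset (Fin (n + 1))}
    (hS : S ⊆ G.neighborFinset i.succ) :
    S.card + degreeIn G A i ≤ G.degree i.succ + ∑ j ∈ A, if j.succ ∈ S then 1 else 0 := by
  set T := (A.filter fun j => G.Adj i.succ j.succ).map (Fin.succEmb n) with hT
  have hTN : T ⊆ G.neighborFinset i.succ := by
    intro v hv
    simp only [hT, Finset.mem_map, Finset.mem_filter] at hv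
    obtain ⟨j, ⟨-, hj⟩, rfl⟩ := hv
    simpa using hj
  have h1 := Finset.card_union_add_card_inter S T
  have h2 : (S ∪ T).card ≤ G.degree i.succ := Finset.card_le_card (Finset.union_subset hS hTN)
  have h3 : (S ∩ T).card ≤ ∑ j ∈ A, if j.succ ∈ S then 1 else 0 := by
    rw [← Finset.card_filter, ← Finset.card_map (Fin.succEmb n)]
    refine Finset.card_le_card fun v hv => ?_
    simp only [hT, Finset.mem_inter, Finset.mem_map, Finset.mem_filter] at hv ⊢
    obtain ⟨hv, j, ⟨hj, -⟩, rfl⟩ := hv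
    exact ⟨j, ⟨hj, hv⟩, rfl⟩
  have h4 : T.card = degreeIn G A i := Finset.card_map _
  omega

/-- Sets avoiding `i` only gain grains. For `insert i B`, the old bound is used on `B` alone: the at
least `deg i` grains at `i`, less those sent outside `B`, still cover the edges from `i` to `B`. -/
theorem DominatesEdges.send {c : Config n} (h : DominatesEdges G c) {i : Fin n}
    (hi : ¬ StableAt G c i) {S : Finset (Fin (n + 1))} (hS : S ⊆ G.neighborFinset i.succ) :
    DominatesEdges G (send c i S) := by
  intro A
  rw [not_stableAt] at hi
  have hSc : S.card ≤ c i := (Finset.card_le_card hS).trans hi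
  have hsum : ∀ B : Finset (Fin n), i ∉ B →
      ∑ j ∈ B, Sandpile.send c i S j = ∑ j ∈ B, c j + ∑ j ∈ B, if j.succ ∈ S then 1 else 0 := by
    intro B hB
    rw [← Finset.sum_add_distrib]
    refine Finset.sum_congr rfl fun j hj => ?_
    have := send_apply_add hSc j
    rwa [if_neg (ne_of_mem_of_not_mem hj hB)] at this
  by_cases hA : i ∈ A
  · obtain ⟨B, hB, rfl⟩ : ∃ B, i ∉ B ∧ insert i B = A :=
      ⟨A.erase i, Finset.notMem_erase i A, Finset.insert_erase hA⟩
    rw [sum_degreeIn_insert hB, Finset.sum_insert hB, hsum B hB]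
    have h1 := h B
    have h2 := card_add_degreeIn_le (A := B) hS
    have h3 := send_apply_add hSc i
    have h4 : i.succ ∉ S := fun hiS => G.loopless.irrefl i.succ (by simpa using hS hiS)
    simp only [if_true, if_neg h4] at h3
    omega
  · rw [hsum A hA]
    have := h A
    omega

theorem DominatesEdges.reflTransGen {c d : Config n} (h : DominatesEdges G c)
    (hcd : Relation.ReflTransGen (ToppleStep G) c d) : DominatesEdges G d := by
  induction hcd with
  | refl => exact h
  | tail _ hstep ih =>
    obtain ⟨i, hi, rfl⟩ := hstep
    exact ih.send hi subset_rfl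

theorem DominatesEdges.asmChain {c : Config n} (h : DominatesEdges G c) (ω : ℕ → Fin n) (k : ℕ) :
    DominatesEdges G (asmChain G c ω k) := by
  induction k with
  | zero => exact h
  | succ k ih => exact (ih.addGrain _).reflTransGen (reflTransGen_stabilise _)

theorem DominatesEdges.randTopplings {r : Config n → Fin n} (hr : IsToppleRule G r)
    {c : Config n} (h : DominatesEdges G c) (b : ℕ → Coins n) (t : ℕ) :
    DominatesEdges G (randTopplings G r b c t) := by
  induction t with
  | zero => exact h
  | succ t ih =>
    rw [Sandpile.randTopplings]
    split_ifs with hs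
    · exact ih
    · exact ih.send (hr _ hs) (Finset.filter_subset _ _)

theorem DominatesEdges.randStabilise {r : Config n → Fin n} (hr : IsToppleRule G r)
    {c : Config n} (h : DominatesEdges G c) (b : ℕ → Coins n) :
    DominatesEdges G (randStabilise G r b c) := by
  unfold Sandpile.randStabilise
  split_ifs
  · exact h.randTopplings hr _ _
  · exact h

theorem DominatesEdges.ssmChain {r : Config n → Fin n} (hr : IsToppleRule G r)
    {c : Config n} (h : DominatesEdges G c) (ω : ℕ → Fin n × (ℕ → Coins n)) (k : ℕ) :
    DominatesEdges G (ssmChain G r c ω k) := by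
  induction k with
  | zero => exact h
  | succ k ih => exact (ih.addGrain _).randStabilise hr _

/-- The inner degrees serve as grain numbers; the edge to the sink makes them stable. -/
theorem exists_isStable_dominatesEdges (hG : ∀ i : Fin n, G.Adj i.succ 0) :
    ∃ c : Config n, IsStable G c ∧ DominatesEdges G c := by
  refine ⟨degreeIn G Finset.univ, fun i => ?_, dominatesEdges_of_le fun i => le_rfl⟩
  rw [StableAt, degree_succ_eq hG i, degreeIn]
  omega

theorem ASMRecurrent.dominatesEdges (hG : ∀ i : Fin n, G.Adj i.succ 0) {μ : PMF (Fin n)}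
    {c : Config n} (h : ASMRecurrent G μ c) : DominatesEdges G c := by
  obtain ⟨c₀, hc₀, hd⟩ := exists_isStable_dominatesEdges hG
  obtain ⟨ω, hω⟩ := (h c₀ hc₀).exists
  obtain ⟨k, rfl⟩ := hω.exists
  exact hd.asmChain ω k

instance (n : ℕ) (p : unitInterval) : IsProbabilityMeasure (coinLaw n p) := by
  unfold coinLaw; infer_instance

instance (μ : PMF (Fin n)) (p : unitInterval) : IsProbabilityMeasure (ssmStepLaw μ p) := by
  unfold ssmStepLaw; infer_instance

theorem SSMRecurrent.dominatesEdges (hG : ∀ i : Fin n, G.Adj i.succ 0) {μ : PMF (Fin n)}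
    {p : unitInterval} {r : Config n → Fin n} (hr : IsToppleRule G r)
    {c : Config n} (h : SSMRecurrent G μ p r c) : DominatesEdges G c := by
  obtain ⟨c₀, hc₀, hd⟩ := exists_isStable_dominatesEdges hG
  obtain ⟨ω, hω⟩ := (h c₀ hc₀).exists
  obtain ⟨k, rfl⟩ := hω.exists
  exact hd.ssmChain hr ω k

end Invariant

/-! ### Combinatorics of the fan. -/

section Fan

variable {n : ℕ}

theorem fan_adj_zero (i : Fin n) : (fan n).Adj i.succ 0 := by
  simp [fan]

theorem fan_adj_succ (i j : Fin n) :
    (fan n).Adj i.succ j.succ ↔ i.val + 1 = j.val ∨ j.val + 1 = i.val := by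
  simp only [fan, Fin.val_succ, ne_eq, Fin.ext_iff, Fin.val_zero]
  omega

theorem DominatesEdges.exists_eq_two {c : Config n} (h : DominatesEdges (fan n) c)
    (hc : ∀ i, c i ≤ 2) {i j : Fin n} (hij : i < j) (hi : c i = 0) (hj : c j = 0) :
    ∃ k, i < k ∧ k < j ∧ c k = 2 := by
  by_contra! hne
  -- Without a 2, interior vertices have at most one grain and inner degree 2, while the ends have
  -- no grain but positive inner degree.
  refine absurd (h (Finset.Icc i j)) (not_le.2 ?_)
  have hij' : i.val < j.val := hij
  have key : ∀ v ∈ Finset.Icc i j, 2 * c v ≤ degreeIn (fan n) (Finset.Icc i j) v := by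
    intro v hv
    have hv' : i ≤ v ∧ v ≤ j := Finset.mem_Icc.1 hv
    rw [Fin.le_def, Fin.le_def] at hv'
    by_cases h1 : v = i
    · simp [h1, hi]
    by_cases h2 : v = j
    · simp [h2, hj]
    rw [Fin.ext_iff] at h1 h2
    have h3 := hne v (Fin.lt_def.2 (by omega)) (Fin.lt_def.2 (by omega))
    have h4 := hc v
    have hcard : 2 ≤ degreeIn (fan n) (Finset.Icc i j) v := by
      refine Finset.one_lt_card.2 ⟨⟨v.val - 1, by omega⟩, ?_, ⟨v.val + 1, by omega⟩, ?_, ?_⟩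
      · rw [Finset.mem_filter, Finset.mem_Icc, Fin.le_def, Fin.le_def, fan_adj_succ]
        dsimp only
        omega
      · rw [Finset.mem_filter, Finset.mem_Icc, Fin.le_def, Fin.le_def, fan_adj_succ]
        dsimp only
        omega
      · simp only [ne_eq, Fin.mk.injEq]
        omega
    omega
  rw [Finset.mul_sum]
  refine Finset.sum_lt_sum key ⟨i, by simp [hij.le], ?_⟩
  rw [hi, mul_zero]
  refine Finset.card_pos.2 ⟨⟨i.val + 1, by omega⟩, ?_⟩
  rw [Finset.mem_filter, Finset.mem_Icc, Fin.le_def, Fin.le_def, fan_adj_succ]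
  dsimp only
  omega

/-- In a counterexample `A`, the leftmost vertex has no grain and its right neighbour lies in `A`.
That neighbour has fewer than 2 grains, and not 0 as no 2 has occurred since the first zero. So it
has 1 grain and needs a right neighbour in `A` too; the run of ones never ends. -/
theorem exists_degreeIn_fan_le {c : Config n}
    (hc : ∀ i j : Fin n, i < j → c i = 0 → c j = 0 → ∃ k : Fin n, i < k ∧ k < j ∧ c k = 2)
    (A : Finset (Fin n)) (hA : A.Nonempty) : ∃ i ∈ A, degreeIn (fan n) A i ≤ c i := by
  by_contra! hlt
  set i := A.min' hA with hi
  have hiA : i ∈ A := A.min'_mem hA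
  have hmin : ∀ a ∈ A, i.val ≤ a.val := fun a ha => A.min'_le a ha
  have h_two : ∀ v, degreeIn (fan n) A v ≤ 2 := by
    intro v
    by_contra! h
    obtain ⟨x, y, z, hx, hy, hz, hxy, hxz, hyz⟩ := Finset.two_lt_card_iff.1 h
    simp only [Finset.mem_filter, fan_adj_succ] at hx hy hz
    rw [ne_eq, Fin.ext_iff] at hxy hxz hyz
    omega
  have h_one : ∀ v, (∀ w ∈ A, w.val ≠ v.val + 1) → degreeIn (fan n) A v ≤ 1 := by
    intro v hv
    refine Finset.card_le_one.2 fun a ha b hb => ?_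
    simp only [Finset.mem_filter, fan_adj_succ] at ha hb
    have h1 := hv a ha.1
    have h2 := hv b hb.1
    rw [Fin.ext_iff]
    omega
  have h_zero : (∀ w ∈ A, w.val ≠ i.val + 1) → degreeIn (fan n) A i = 0 := by
    intro hv
    refine Finset.card_eq_zero.2 (Finset.eq_empty_of_forall_notMem fun a ha => ?_)
    simp only [Finset.mem_filter, fan_adj_succ] at ha
    have h1 := hv a ha.1
    have h2 := hmin a ha.1
    omega
  have hci : c i = 0 := by
    have h1 : degreeIn (fan n) A i ≤ 1 := by
      refine Finset.card_le_one.2 fun a ha b hb => ?_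
      simp only [Finset.mem_filter, fan_adj_succ] at ha hb
      have h1 := hmin a ha.1
      have h2 := hmin b hb.1
      rw [Fin.ext_iff]
      omega
    have := hlt i hiA
    omega
  have hrun : ∀ m : ℕ, ∃ v ∈ A, v.val = i.val + m ∧ ∀ k, i < k → k ≤ v → c k = 1 := by
    intro m
    induction m with
    | zero => exact ⟨i, hiA, rfl, fun k h1 h2 => absurd h1 (not_lt.2 h2)⟩
    | succ m ih =>
      obtain ⟨v, hvA, hv, hone⟩ := ih
      obtain ⟨w, hwA, hw⟩ : ∃ w ∈ A, w.val = v.val + 1 := by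
        by_contra! hno
        have h1 := hlt v hvA
        have h2 := h_one v hno
        by_cases hvi : v = i
        · rw [hvi] at hno h1
          have := h_zero hno
          omega
        · have := hone v (lt_of_le_of_ne (hmin v hvA) (Ne.symm hvi)) le_rfl
          omega
      have hiw : i < w := Fin.lt_def.2 (by omega)
      refine ⟨w, hwA, by omega, fun k h1 h2 => ?_⟩
      by_cases hkw : k = w
      · subst hkw
        have h3 := hlt k hwA
        have h4 := h_two k
        have h5 : c k ≠ 0 := by
          intro h0
          obtain ⟨l, hil, hlk, hl⟩ := hc i k hiw hci h0
          have := hone l hil (Fin.le_def.2 (by rw [Fin.lt_def] at hlk; omega))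
          omega
        omega
      · refine hone k h1 (Fin.le_def.2 ?_)
        rw [Fin.ext_iff] at hkw
        rw [Fin.le_def] at h2
        omega
  obtain ⟨v, -, hv, -⟩ := hrun n
  omega

end Fan

end Sandpile

namespace Sandpile

/-! ### From reachability to infinitely many visits. -/

section Synchronisation

variable {E S α : Type*}

/-- In an i.i.d. sequence, each pattern of non-null events almost surely occurs infinitely
often. -/
theorem ae_frequently_pattern [MeasurableSpace E] (ν : Measure E) [IsProbabilityMeasure ν] (L : ℕ)
    (A : ℕ → Set E) (hA : ∀ l, MeasurableSet (A l)) (hpos : ∀ l, ν (A l) ≠ 0) :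
    ∀ᵐ ω ∂(Measure.infinitePi fun _ : ℕ => ν), ∃ᶠ k in atTop, ∀ l < L, ω (k + l) ∈ A l := by
  -- Disjoint blocks give independent events of equal positive probability, so Borel–Cantelli
  -- applies. The period `L + 1` stays positive for `L = 0`.
  let block : ℕ → Finset ℕ := fun m => (Finset.range L).image (m * (L + 1) + ·)
  let t : ℕ → Set E := fun j => A (j % (L + 1))
  let s : ℕ → Set (ℕ → E) := fun m => Set.pi (block m) t
  have hblock : ∀ {m j}, j ∈ block m → j / (L + 1) = m := by
    intro m j hj
    obtain ⟨l, hl, rfl⟩ := Finset.mem_image.1 hj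
    have hl : l < L := Finset.mem_range.1 hl
    rw [mul_comm, Nat.mul_add_div (by omega), Nat.div_eq_of_lt (by omega), add_zero]
  have ht : ∀ m, ∀ l < L, t (m * (L + 1) + l) = A l := by
    intro m l hl
    simp only [t]
    rw [mul_comm, Nat.mul_add_mod, Nat.mod_eq_of_lt (by omega)]
  have hmeas : ∀ m, MeasurableSet (s m) := fun m =>
    MeasurableSet.pi (Finset.countable_toSet _) fun j _ => hA _
  have hs : ∀ m, Measure.infinitePi (fun _ : ℕ => ν) (s m) = ∏ j ∈ block m, ν (t j) := fun m =>
    Measure.infinitePi_pi _ fun j _ => hA _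
  have hs' : ∀ m, Measure.infinitePi (fun _ : ℕ => ν) (s m) = ∏ l ∈ Finset.range L, ν (A l) := by
    intro m
    rw [hs, Finset.prod_image fun a _ b _ h => by simpa using h]
    exact Finset.prod_congr rfl fun l hl => by rw [ht m l (Finset.mem_range.1 hl)]
  have hind : iIndepSet s (Measure.infinitePi fun _ : ℕ => ν) := by
    rw [iIndepSet_iff_meas_biInter hmeas]
    intro K
    have h1 : ⋂ m ∈ K, s m = Set.pi (K.biUnion block) t := by
      ext ω
      simp only [s, Set.mem_iInter, Set.mem_pi, Finset.mem_coe, Finset.mem_biUnion]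
      exact ⟨fun h j ⟨m, hm, hj⟩ => h m hm j hj, fun h m hm j hj => h j ⟨m, hm, hj⟩⟩
    rw [h1, Measure.infinitePi_pi _ fun j _ => hA _, Finset.prod_biUnion]
    · exact Finset.prod_congr rfl fun m _ => (hs m).symm
    · intro m _ m' _ hne
      rw [Function.onFun, Finset.disjoint_left]
      exact fun j hj hj' => hne ((hblock hj).symm.trans (hblock hj'))
  have hlim := measure_limsup_eq_one hmeas hind (by
    simp only [hs']
    exact ENNReal.tsum_const_eq_top_of_ne_zero (Finset.prod_ne_zero_iff.2 fun l _ => hpos l))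
  have hae := (mem_ae_iff_prob_eq_one (MeasurableSet.measurableSet_limsup hmeas)).2 hlim
  filter_upwards [hae] with ω hω
  rw [mem_limsup_iff_frequently_mem] at hω
  rw [frequently_atTop] at hω ⊢
  intro N
  obtain ⟨m, hm, hmω⟩ := hω N
  refine ⟨m * (L + 1), hm.trans (Nat.le_mul_of_pos_right m (Nat.succ_pos L)), fun l hl => ?_⟩
  rw [← ht m l hl]
  exact hmω _ (Finset.mem_coe.2 (Finset.mem_image_of_mem _ (Finset.mem_range.2 hl)))

/-- Words are concatenated: for each further state, append one leading from its current image to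
`c`. Different states may hit `c` after different prefixes. -/
theorem exists_synchronising_word (f : S → α → S) (P : S → Prop) (hP : ∀ x i, P x → P (f x i))
    (c : S) (hreach : ∀ x, P x → ∃ w : List α, w.foldl f x = c) (T : Finset S)
    (hT : ∀ x ∈ T, P x) : ∃ w : List α, ∀ x ∈ T, ∃ l ≤ w.length, (w.take l).foldl f x = c := by
  classical
  have hfold : ∀ (w : List α) x, P x → P (w.foldl f x) := by
    intro w
    induction w with
    | nil => exact fun x hx => hx
    | cons i w ih => exact fun x hx => ih _ (hP x i hx)
  induction T using Finset.induction_on with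
  | empty => exact ⟨[], by simp⟩
  | insert x T hx ih =>
    obtain ⟨w, hw⟩ := ih fun y hy => hT y (Finset.mem_insert_of_mem hy)
    obtain ⟨w', hw'⟩ := hreach _ (hfold w x (hT x (Finset.mem_insert_self x T)))
    refine ⟨w ++ w', fun y hy => ?_⟩
    rcases Finset.mem_insert.1 hy with rfl | hy
    · exact ⟨(w ++ w').length, le_rfl, by rw [List.take_length, List.foldl_append, hw']⟩
    · obtain ⟨l, hl, h⟩ := hw y hy
      exact ⟨l, by rw [List.length_append]; omega, by rw [List.take_append_of_le_length hl, h]⟩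

/-- A chain driven by i.i.d. innovations on a finite set `P` of states visits `c` infinitely often,
if the steps of a deterministic automaton `f`, which leads from each state to `c`, are imitated
with positive probability. -/
theorem ae_frequently_eq [MeasurableSpace E] (ν : Measure E) [IsProbabilityMeasure ν]
    (F : S → E → S) (f : S → α → S) (P : S → Prop) (hfin : {x | P x}.Finite)
    (hP : ∀ x i, P x → P (f x i)) (hFP : ∀ᵐ e ∂ν, ∀ x, P x → P (F x e))
    (A : α → Set E) (hA : ∀ i, MeasurableSet (A i)) (hpos : ∀ i, ν (A i) ≠ 0)
    (hF : ∀ x, P x → ∀ i, ∀ e ∈ A i, F x e = f x i)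
    (c : S) (hreach : ∀ x, P x → ∃ w : List α, w.foldl f x = c)
    (X : (ℕ → E) → ℕ → S) (hX₀ : ∀ ω, P (X ω 0)) (hX : ∀ ω k, X ω (k + 1) = F (X ω k) (ω k)) :
    ∀ᵐ ω ∂(Measure.infinitePi fun _ : ℕ => ν), ∃ᶠ k in atTop, X ω k = c := by
  -- One word serves all states, so the random state at the start of its occurrence is irrelevant
  -- and no conditioning is needed.
  obtain ⟨w, hw⟩ := exists_synchronising_word f P hP c hreach hfin.toFinset (by simp)
  let B : ℕ → Set E := fun l => if h : l < w.length then A w[l] else Set.univ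
  have hB : ∀ l, MeasurableSet (B l) := by
    intro l; simp only [B]; split_ifs
    exacts [hA _, MeasurableSet.univ]
  have hBpos : ∀ l, ν (B l) ≠ 0 := by
    intro l; simp only [B]; split_ifs
    · exact hpos _
    · simp
  have hall : ∀ᵐ ω ∂(Measure.infinitePi fun _ : ℕ => ν), ∀ k, ∀ x, P x → P (F x (ω k)) :=
    ae_all_iff.2 fun k =>
      (measurePreserving_eval_infinitePi (fun _ : ℕ => ν) k).quasiMeasurePreserving.ae hFP
  filter_upwards [ae_frequently_pattern ν w.length B hB hBpos, hall] with ω hω hωP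
  have hXP : ∀ k, P (X ω k) := by
    intro k
    induction k with
    | zero => exact hX₀ ω
    | succ k ih => rw [hX]; exact hωP k _ ih
  rw [frequently_atTop] at hω ⊢
  intro N
  obtain ⟨k, hk, hkw⟩ := hω N
  have hfoll : ∀ l ≤ w.length, X ω (k + l) = (w.take l).foldl f (X ω k) := by
    intro l
    induction l with
    | zero => simp
    | succ l ih =>
      intro hl
      have hl' : l < w.length := hl
      have h1 := hkw l hl'
      simp only [B, dif_pos hl'] at h1
      rw [← add_assoc, hX, hF _ (hXP _) _ _ h1, ih hl'.le, List.take_succ_eq_append_getElem hl',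
        List.foldl_append]
      rfl
  obtain ⟨l, hl, hlc⟩ := hw (X ω k) (by simpa using hXP k)
  exact ⟨k + l, by omega, (hfoll l hl).trans hlc⟩

end Synchronisation

/-! ### Recurrence of both chains. -/

section Recurrence

variable {n : ℕ} {G : SimpleGraph (Fin (n + 1))} [DecidableRel G.Adj]

theorem finite_isStable : {c : Config n | IsStable G c}.Finite :=
  (Set.finite_Iic (fun _ : Fin n => n)).subset fun _ hc i => hc.le i

theorem asmRecurrent_of_burning (hG : ∀ i : Fin n, G.Adj i.succ 0) {μ : PMF (Fin n)}
    (hμ : ∀ i, 0 < μ i) {c : Config n} (hc : IsStable G c)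
    (hburn : Relation.ReflTransGen (ToppleStep G) (c + 1) c) : ASMRecurrent G μ c := by
  intro c₀ hc₀
  refine ae_frequently_eq μ.toMeasure (asmStep G) (asmStep G) (IsStable G) finite_isStable
    (fun x i _ => isStable_asmStep hG x i) (ae_of_all _ fun i x _ => isStable_asmStep hG x i)
    (fun i => {i}) (fun i => measurableSet_singleton i) (fun i => ?_) ?_ c
    (fun x hx => exists_foldl_asmStep_eq hG hc hburn hx) (asmChain G c₀) (fun _ => hc₀)
    (fun _ _ => rfl)
  · rw [PMF.toMeasure_apply_singleton _ _ (measurableSet_singleton i)]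
    exact (hμ i).ne'
  · rintro x - i e rfl
    rfl

theorem sum_randTopple_add {c : Config n} {i : Fin n} (hG : G.Adj i.succ 0)
    (hi : ¬ StableAt G c i) (b : Coins n) :
    ∑ j, randTopple G c i b j + (if b 0 = true then 1 else 0) = ∑ j, c j := by
  have := sum_send_add (S := (G.neighborFinset i.succ).filter fun j => b j = true)
    ((Finset.card_le_card (Finset.filter_subset _ _)).trans (not_stableAt.1 hi))
  simpa [hG, randTopple] using this

theorem randTopple_of_forall {c : Config n} {i : Fin n} {b : Coins n} (hb : ∀ v, b v = true) :
    randTopple G c i b = topple G c i := by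
  simp [randTopple, topple, hb]

variable {r : Config n → Fin n}

theorem randTopplings_succ_of_not {b : ℕ → Coins n} {c : Config n} {t : ℕ}
    (h : ¬ IsStable G (randTopplings G r b c t)) :
    randTopplings G r b c (t + 1) =
      randTopple G (randTopplings G r b c t) (r (randTopplings G r b c t)) (b t) := by
  rw [randTopplings, if_neg h]

/-- Each `true` coin of the sink removes a grain, which cannot happen indefinitely. -/
theorem exists_isStable_randTopplings (hG : ∀ i : Fin n, G.Adj i.succ 0) (hr : IsToppleRule G r)
    {b : ℕ → Coins n} (hb : ∃ᶠ t in atTop, b t 0 = true) (c : Config n) :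
    ∃ t, IsStable G (randTopplings G r b c t) := by
  by_contra! hns
  have hstep : ∀ t, ∑ j, randTopplings G r b c (t + 1) j + (if b t 0 = true then 1 else 0) =
      ∑ j, randTopplings G r b c t j := fun t => by
    rw [randTopplings_succ_of_not (hns t)]
    exact sum_randTopple_add (hG _) (hr _ (hns t)) (b t)
  have hanti : Antitone fun t => ∑ j, randTopplings G r b c t j :=
    antitone_nat_of_succ_le fun t => by
      have := hstep t
      omega
  have key : ∀ m, ∃ t, ∑ j, randTopplings G r b c t j + m ≤ ∑ j, c j := by
    intro m
    induction m with
    | zero => exact ⟨0, le_rfl⟩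
    | succ m ih =>
      obtain ⟨t, ht⟩ := ih
      obtain ⟨s, hs, hbs⟩ := frequently_atTop.1 hb t
      have h1 := hstep s
      rw [if_pos hbs] at h1
      have h2 : ∑ j, randTopplings G r b c s j ≤ ∑ j, randTopplings G r b c t j := hanti hs
      exact ⟨s + 1, by omega⟩
  obtain ⟨t, ht⟩ := key (∑ j, c j + 1)
  omega

theorem exists_randStabilise_eq {b : ℕ → Coins n} {c : Config n} {T : ℕ}
    (h : IsStable G (randTopplings G r b c T)) :
    ∃ t ≤ T, randStabilise G r b c = randTopplings G r b c t ∧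
      IsStable G (randTopplings G r b c t) := by
  classical
  have h' : ∃ t, IsStable G (randTopplings G r b c t) := ⟨T, h⟩
  rw [randStabilise, dif_pos h']
  exact ⟨_, Nat.find_min' h' h, rfl, Nat.find_spec h'⟩

theorem reflTransGen_randTopplings (hr : IsToppleRule G r) {b : ℕ → Coins n} {c : Config n}
    {t : ℕ} (hb : ∀ s < t, ∀ v, b s v = true) :
    Relation.ReflTransGen (ToppleStep G) c (randTopplings G r b c t) := by
  induction t with
  | zero => exact .refl
  | succ t ih =>
    have ih := ih fun s hs => hb s (by omega)
    by_cases h : IsStable G (randTopplings G r b c t)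
    · rwa [randTopplings, if_pos h]
    · rw [randTopplings_succ_of_not h, randTopple_of_forall (hb t (by omega))]
      exact ih.tail ⟨_, hr _ h, rfl⟩

theorem isStable_randTopplings_or (hG : ∀ i : Fin n, G.Adj i.succ 0) (hr : IsToppleRule G r)
    {b : ℕ → Coins n} {c : Config n} {t : ℕ} (hb : ∀ s < t, ∀ v, b s v = true) :
    IsStable G (randTopplings G r b c t) ∨ ∑ j, randTopplings G r b c t j + t ≤ ∑ j, c j := by
  induction t with
  | zero => exact Or.inr le_rfl
  | succ t ih =>
    by_cases h : IsStable G (randTopplings G r b c t)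
    · left
      rwa [randTopplings, if_pos h]
    · right
      have h1 := (ih fun s hs => hb s (by omega)).resolve_left h
      have h2 := sum_randTopple_add (hG _) (hr _ h) (b t)
      rw [← randTopplings_succ_of_not h, if_pos (hb t (by omega) 0)] at h2
      omega

/-- If all coins show `true`, the random stabilisation is the Abelian one. -/
theorem randStabilise_eq_stabilise (hG : ∀ i : Fin n, G.Adj i.succ 0) (hr : IsToppleRule G r)
    {b : ℕ → Coins n} {c : Config n} {T : ℕ} (hT : ∑ j, c j < T)
    (hb : ∀ s < T, ∀ v, b s v = true) : randStabilise G r b c = stabilise G c := by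
  obtain ⟨t, htT, ht, hs⟩ := exists_randStabilise_eq
    ((isStable_randTopplings_or (c := c) hG hr hb).resolve_right (by omega))
  rw [ht]
  exact IsStabilisation.unique
    ⟨reflTransGen_randTopplings hr fun s hsT => hb s (hsT.trans_le htT), hs⟩
    (isStabilisation_stabilise hG c)

theorem coinLaw_forall_ne_zero {p : unitInterval} (hp : 0 < p) :
    coinLaw n p {b | ∀ v, b v = true} ≠ 0 := by
  have h : {b : Coins n | ∀ v, b v = true} = Set.univ.pi fun _ => {true} := by
    ext b; simp
  rw [h, coinLaw, Measure.pi_pi, Finset.prod_ne_zero_iff]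
  intro v _
  rw [bernoulliMeasure_apply _ (measurableSet_singleton _)]
  have h0 : unitInterval.toNNReal p ≠ 0 := fun h => hp.ne' (Subtype.ext (congrArg NNReal.toReal h))
  simpa using h0

theorem ae_frequently_coin {p : unitInterval} (hp : 0 < p) :
    ∀ᵐ b ∂(Measure.infinitePi fun _ : ℕ => coinLaw n p), ∃ᶠ t in atTop, b t 0 = true := by
  have := ae_frequently_pattern (coinLaw n p) 1 (fun _ => {b | ∀ v, b v = true})
    (fun _ => MeasurableSet.of_discrete) (fun _ => coinLaw_forall_ne_zero hp)
  filter_upwards [this] with b hb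
  exact hb.mono fun t ht => ht 0 one_pos 0

theorem ssmRecurrent_of_burning (hG : ∀ i : Fin n, G.Adj i.succ 0) {μ : PMF (Fin n)}
    (hμ : ∀ i, 0 < μ i) {p : unitInterval} (hp : 0 < p) (hr : IsToppleRule G r) {c : Config n}
    (hc : IsStable G c) (hburn : Relation.ReflTransGen (ToppleStep G) (c + 1) c) :
    SSMRecurrent G μ p r c := by
  intro c₀ hc₀
  -- A stable configuration has at most `n * n` grains; one is added, and the bound must be strict.
  let T := n * n + 2
  let D : Set (ℕ → Coins n) := Set.pi (Finset.range T) fun _ => {b | ∀ v, b v = true}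
  have hD : MeasurableSet D :=
    MeasurableSet.pi (Finset.countable_toSet _) fun _ _ => MeasurableSet.of_discrete
  refine ae_frequently_eq (ssmStepLaw μ p) (fun x e => randStabilise G r e.2 (addGrain x e.1))
    (asmStep G) (IsStable G) finite_isStable (fun x i _ => isStable_asmStep hG x i) ?_
    (fun i => {i} ×ˢ D) (fun i => (measurableSet_singleton i).prod hD) (fun i => ?_) ?_ c
    (fun x hx => exists_foldl_asmStep_eq hG hc hburn hx) (ssmChain G r c₀) (fun _ => hc₀)
    (fun _ _ => rfl)
  -- Stability is preserved only almost surely: `randStabilise` returns its argument if the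
  -- topplings never end.
  · filter_upwards [Measure.quasiMeasurePreserving_snd.ae (ae_frequently_coin hp)] with e he x _
    obtain ⟨t, ht⟩ := exists_isStable_randTopplings hG hr he (addGrain x e.1)
    obtain ⟨t, -, h, hs⟩ := exists_randStabilise_eq ht
    rwa [h]
  · rw [ssmStepLaw, Measure.prod_prod,
      PMF.toMeasure_apply_singleton _ _ (measurableSet_singleton i),
      Measure.infinitePi_pi _ fun _ _ => MeasurableSet.of_discrete]
    exact mul_ne_zero (hμ i).ne' (Finset.prod_ne_zero_iff.2 fun _ _ => coinLaw_forall_ne_zero hp)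
  · rintro x hx i ⟨i', b⟩ ⟨rfl, hb⟩
    refine randStabilise_eq_stabilise hG hr (T := T) ?_ fun s hs v =>
      hb s (Finset.mem_coe.2 (Finset.mem_range.2 hs)) v
    have h1 : ∑ j, x j ≤ n * n := by
      simpa using Finset.sum_le_card_nsmul Finset.univ x n fun j _ => hx.le j
    simp only [addGrain, Pi.add_apply, Finset.sum_add_distrib, Finset.sum_pi_single',
      Finset.mem_univ, if_true, T]
    omega

end Recurrence

end Sandpile

/-- The vertex `k` of the path (`1 ≤ k ≤ n`) is the index `k - 1 : Fin n`. -/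
theorem theorem5p1 (n : ℕ) (hn : 1 ≤ n)
    (μ : PMF (Fin n)) (hμ : ∀ i, 0 < μ i)
    (p : unitInterval) (hp₀ : 0 < p) (hp₁ : p < 1)
    (r : Sandpile.Config n → Fin n) (hr : Sandpile.IsToppleRule (Sandpile.fan n) r)
    (c : Sandpile.Config n) (hc : Sandpile.IsStable (Sandpile.fan n) c)
    (hc₂ : ∀ i, c i ∈ ({0, 1, 2} : Set ℕ))
    (hc_first : c ⟨0, by omega⟩ ≤ 1) (hc_last : c ⟨n - 1, by omega⟩ ≤ 1) :
    (Sandpile.ASMRecurrent (Sandpile.fan n) μ c ↔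
      ∀ i j : Fin n, i < j → c i = 0 → c j = 0 → ∃ k : Fin n, i < k ∧ k < j ∧ c k = 2) ∧
    (Sandpile.SSMRecurrent (Sandpile.fan n) μ p r c ↔
      ∀ i j : Fin n, i < j → c i = 0 → c j = 0 → ∃ k : Fin n, i < k ∧ k < j ∧ c k = 2) := by
  have hle : ∀ i, c i ≤ 2 := fun i => by
    have := hc₂ i
    simp only [Set.mem_insert_iff, Set.mem_singleton_iff] at this
    omega
  have hG := Sandpile.fan_adj_zero (n := n)
  have hburn := fun h => Sandpile.reflTransGen_add_one hG (Sandpile.exists_degreeIn_fan_le (c := c) h)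
  exact ⟨⟨fun h _ _ => (h.dominatesEdges hG).exists_eq_two hle,
      fun h => Sandpile.asmRecurrent_of_burning hG hμ hc (hburn h)⟩,
    ⟨fun h _ _ => (h.dominatesEdges hG hr).exists_eq_two hle,
      fun h => Sandpile.ssmRecurrent_of_burning hG hμ hp₀ hr hc (hburn h)⟩⟩
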